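/- Let $d,N$ be natural numbers, let $R$ be a real $d\times d$ matrix all of whose eigenvalues have modulus $>1$, and suppose $R^{-1}=\lambda O$ with $0<\lambda<1$ and $O$ an orthogonal matrix. Let $b_1,\dots,b_N\in\mathbb R^d$ be distinct, let $p_1,\dots,p_N>0$ with $\sum_{i=1}^N p_i=1$, and put $\tau_i(x)=R^{-1}(x+b_i)$ for $x\in\mathbb R^d$. Let $X$ be the attractor, i.e. the unique nonempty compact set with $X=\bigcup_{i=1}^N\tau_i(X)$, and let $\mu$ be the self-similar measure, i.e. the unique Borel probability measure on $\mathbb R^d$ with $\mu(E)=\sum_{i=1}^N p_i\,\mu(\tau_i^{-1}(E))$ for all Borel sets $E$. Assume that $\mu$ is absolutely continuous with respect to Lebesgue measure $\mathcal L$ on $\mathbb R^d$, and that $\mu$ has a frame measure, i.e. there are a Borel measure $\nu$ on $\mathbb R^d$ and constants $A,B>0$ such that for all $f\in L^2(\mu)$ $$A\|f\|_{L^2(\mu)}^2\le\int\Bigl|\int f(x)e^{-2\pi i t\cdot x}\,d\mu(x)\Bigr|^2d\nu(t)\le B\|f\|_{L^2(\mu)}^2 .$$ For a word $J=j_1\cdots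 j_n\in\{1,\dots,N\}^n$ write $\tau_J=\tau_{j_1}\circ\cdots\circ\tau_{j_n}$. Suppose that there is a word $I\in\{1,\dots,N\}^n$, for some $n\ge1$, which contains every digit in $\{1,\dots,N\}$ and such that the fixed point $x_I$ of $\tau_I$ belongs to none of the sets $\tau_J(X)$ with $J\in\{1,\dots,N\}^n$, $J\ne I$. Then all the weights $p_i$ are equal, $\lambda^d=\frac1N$, there is no overlap, i.e. $\mu(\tau_i(X)\cap\tau_j(X))=0$ for all $i\ne j$, and $\frac{d\mu}{d\mathcal L}=\frac1{\mathcal L(X)}\chi_X$ $\mathcal L$-almost everywhere. -/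

import Mathlib

open MeasureTheory

/-- The Fourier transform `t ↦ ∫ f(x) e^{-2π i t·x} dμ(x)` of `f dμ`, for a Borel measure `μ`
on `ℝ^d`. -/
noncomputable def fourierTransformMeasure {d : ℕ} (μ : Measure (EuclideanSpace ℝ (Fin d)))
    (f : EuclideanSpace ℝ (Fin d) → ℂ) : EuclideanSpace ℝ (Fin d) → ℂ :=
  VectorFourier.fourierIntegral Real.fourierChar μ (innerₗ (EuclideanSpace ℝ (Fin d))) f

/-- `ν` is a frame measure for `μ`: there are `A, B > 0` such that
`A ‖f‖²_{L²(μ)} ≤ ‖(f dμ)^‖²_{L²(ν)} ≤ B ‖f‖²_{L²(μ)}` for all `f ∈ L²(μ)`. -/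
def IsFrameMeasure {d : ℕ} (ν μ : Measure (EuclideanSpace ℝ (Fin d))) : Prop :=
  ∃ A B : ℝ, 0 < A ∧ 0 < B ∧ ∀ f : EuclideanSpace ℝ (Fin d) → ℂ, MemLp f 2 μ →
    ENNReal.ofReal A * eLpNorm f 2 μ ^ 2 ≤ eLpNorm (fourierTransformMeasure μ f) 2 ν ^ 2 ∧
    eLpNorm (fourierTransformMeasure μ f) 2 ν ^ 2 ≤ ENNReal.ofReal B * eLpNorm f 2 μ ^ 2

/-- A real square matrix is expansive if all its (complex) eigenvalues have modulus
greater than `1`. -/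
def Matrix.IsExpansive {d : ℕ} (R : Matrix (Fin d) (Fin d) ℝ) : Prop :=
  ∀ z ∈ spectrum ℂ (R.map (algebraMap ℝ ℂ)), 1 < ‖z‖

/-- The data of an affine iterated function system on `ℝ^d` with `N` maps: an expansive
matrix `R`, distinct digits `b_i`, and positive probability weights `p_i`. -/
structure AffineIFS (d N : ℕ) where
  R : Matrix (Fin d) (Fin d) ℝ
  expansive : R.IsExpansive
  b : Fin N → EuclideanSpace ℝ (Fin d)
  b_injective : Function.Injective b
  p : Fin N → ℝ
  p_pos : ∀ i, 0 < p i
  p_sum : ∑ i, p i = 1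

namespace AffineIFS

variable {d N : ℕ} (S : AffineIFS d N)

/-- The maps `τ_i(x) = R⁻¹ (x + b_i)`. -/
noncomputable def tau (i : Fin N) (x : EuclideanSpace ℝ (Fin d)) : EuclideanSpace ℝ (Fin d) :=
  Matrix.toEuclideanLin S.R⁻¹ (x + S.b i)

/-- For a word `I = i₁ ⋯ i_n`, the composition `τ_I = τ_{i₁} ∘ ⋯ ∘ τ_{i_n}`. -/
noncomputable def tauWord : List (Fin N) → EuclideanSpace ℝ (Fin d) → EuclideanSpace ℝ (Fin d)
  | [] => id
  | i :: I => S.tau i ∘ tauWord I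

/-- `X` is the attractor: the (unique) nonempty compact set with `X = ⋃ᵢ τ_i(X)`. -/
structure IsAttractor (X : Set (EuclideanSpace ℝ (Fin d))) : Prop where
  isCompact : IsCompact X
  nonempty : X.Nonempty
  eq_iUnion : X = ⋃ i, S.tau i '' X

/-- `μ` is the invariant measure: the (unique) Borel probability measure with
`μ(E) = ∑ᵢ p_i μ(τ_i⁻¹(E))` for all Borel sets `E`. -/
structure IsInvariantMeasure (μ : Measure (EuclideanSpace ℝ (Fin d))) : Prop where
  isProbabilityMeasure : IsProbabilityMeasure μ
  apply_eq_sum : ∀ E : Set (EuclideanSpace ℝ (Fin d)), MeasurableSet E →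
    μ E = ∑ i, ENNReal.ofReal (S.p i) * μ (S.tau i ⁻¹' E)

/-- The system is self-similar with contraction ratio `r`: `R⁻¹ = r O` with `0 < r < 1` and `O`
an orthogonal matrix. -/
def IsSelfSimilar (r : ℝ) : Prop :=
  0 < r ∧ r < 1 ∧ ∃ O ∈ Matrix.orthogonalGroup (Fin d) ℝ, S.R⁻¹ = r • O

/-- No overlap: `μ(τ_i(X) ∩ τ_j(X)) = 0` for all `i ≠ j`; here `X` is the attractor and `μ` is
the invariant measure. -/
def NoOverlap (X : Set (EuclideanSpace ℝ (Fin d)))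
    (μ : Measure (EuclideanSpace ℝ (Fin d))) : Prop :=
  ∀ i j, i ≠ j → μ (S.tau i '' X ∩ S.tau j '' X) = 0

end AffineIFS

/-! Write `g` for the density of `μ`. Translating an absolutely continuous complex measure only
multiplies its Fourier transform by a unimodular factor. Testing the frame inequalities on two
functions whose measures `f₁ dμ` and `f₂ dμ` are translates of each other therefore compares `g (x +
a)` with `g x` (`ae_frame_bound_translate`). By Fubini, `g` is essentially bounded above and away
from zero on `V = {g > 0}` (`exists_bounds_of_isFrameMeasure`).

The two bounds pin down the weights. The image of `X` under the `k`-th iterate of `τ_i` has mass at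
least `p_i ^ k` and volume `r ^ (d k) * volume X`, so the upper bound on `g` gives `p_i ≤ r ^ d`
(`weight_le`). Near the fixed point of `τ_I` only the word `I` contributes mass, so small balls
there lose mass exactly by the factor `weight I`. Their part inside `V` loses volume at most by `r ^
(d n)`, where `n` is the length of `I`, so the lower bound on `g` gives `r ^ (d n) ≤ weight I`
(`le_weight`). Since `I` contains every digit, the two estimates force `p_i = r ^ d` for all `i`.

Summing the weights gives `N r ^ d = 1`. The pieces `τ_i X` then have total volume `volume X`, so
they overlap in null sets and normalized Lebesgue measure on `X` is invariant. Uniqueness of the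
invariant measure identifies it with `μ`. -/

/-- An orthogonal matrix acts isometrically on Euclidean space. -/
lemma Matrix.norm_toEuclideanLin_of_mem_orthogonalGroup {d : ℕ} {O : Matrix (Fin d) (Fin d) ℝ}
    (hO : O ∈ Matrix.orthogonalGroup (Fin d) ℝ) (v : EuclideanSpace ℝ (Fin d)) :
    ‖Matrix.toEuclideanLin O v‖ = ‖v‖ := by
  have h1 : star O * O = 1 := (Matrix.mem_orthogonalGroup_iff' (Fin d) ℝ).1 hO
  have key : ‖Matrix.toEuclideanLin O v‖ ^ 2 = ‖v‖ ^ 2 := by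
    rw [← real_inner_self_eq_norm_sq, ← real_inner_self_eq_norm_sq,
      EuclideanSpace.inner_eq_star_dotProduct, EuclideanSpace.inner_eq_star_dotProduct]
    simp only [star_trivial, Matrix.ofLp_toLpLin, Matrix.toLin'_apply]
    rw [Matrix.dotProduct_mulVec, ← Matrix.mulVec_transpose, Matrix.mulVec_mulVec]
    rw [Matrix.star_eq_conjTranspose, Matrix.conjTranspose_eq_transpose_of_trivial] at h1
    rw [h1, Matrix.one_mulVec]
  exact (sq_eq_sq₀ (norm_nonneg _) (norm_nonneg _)).1 key

lemma Matrix.abs_det_of_mem_orthogonalGroup {d : ℕ} {O : Matrix (Fin d) (Fin d) ℝ}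
    (hO : O ∈ Matrix.orthogonalGroup (Fin d) ℝ) : |O.det| = 1 := by
  have h1 : star O * O = 1 := (Matrix.mem_orthogonalGroup_iff' (Fin d) ℝ).1 hO
  have h2 : O.det * O.det = 1 := by
    have := congrArg Matrix.det h1
    rwa [Matrix.det_mul, Matrix.star_eq_conjTranspose,
      Matrix.conjTranspose_eq_transpose_of_trivial, Matrix.det_transpose, Matrix.det_one] at this
  rcases mul_self_eq_one_iff.1 h2 with h | h <;> simp [h]

/-! ### Geometry of the similarities and their cylinders. -/

namespace AffineIFS

variable {d N : ℕ} {S : AffineIFS d N} {r : ℝ} {X : Set (EuclideanSpace ℝ (Fin d))}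
  {μ : Measure (EuclideanSpace ℝ (Fin d))}

/-- The probability weight of a word. -/
noncomputable def weight (S : AffineIFS d N) (I : List (Fin N)) : ℝ := (I.map S.p).prod

lemma weight_nil (S : AffineIFS d N) : S.weight [] = 1 := rfl

lemma weight_cons (S : AffineIFS d N) (i : Fin N) (I : List (Fin N)) :
    S.weight (i :: I) = S.p i * S.weight I := by simp [weight]

lemma weight_pos (S : AffineIFS d N) (I : List (Fin N)) : 0 < S.weight I := by
  induction I with
  | nil => simp [weight_nil]
  | cons i I ih => rw [weight_cons]; exact mul_pos (S.p_pos i) ih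

lemma IsSelfSimilar.norm_toEuclideanLin (hS : S.IsSelfSimilar r)
    (v : EuclideanSpace ℝ (Fin d)) : ‖Matrix.toEuclideanLin S.R⁻¹ v‖ = r * ‖v‖ := by
  obtain ⟨h0, _, O, hO, h⟩ := hS
  rw [h, map_smul, LinearMap.smul_apply, norm_smul,
    Matrix.norm_toEuclideanLin_of_mem_orthogonalGroup hO, Real.norm_of_nonneg h0.le]

lemma IsSelfSimilar.abs_det (hS : S.IsSelfSimilar r) :
    |LinearMap.det (Matrix.toEuclideanLin S.R⁻¹)| = r ^ d := by
  obtain ⟨h0, _, O, hO, h⟩ := hS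
  rw [h, Matrix.toEuclideanLin, Matrix.toLpLin_eq_toLin, LinearMap.det_toLin, Matrix.det_smul, abs_mul,
    Matrix.abs_det_of_mem_orthogonalGroup hO, Fintype.card_fin, mul_one,
    abs_of_nonneg (pow_nonneg h0.le _)]

lemma IsSelfSimilar.dist_tau (hS : S.IsSelfSimilar r) (i : Fin N)
    (x y : EuclideanSpace ℝ (Fin d)) : dist (S.tau i x) (S.tau i y) = r * dist x y := by
  rw [tau, tau, dist_eq_norm, ← map_sub, hS.norm_toEuclideanLin, add_sub_add_right_eq_sub,
    dist_eq_norm]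

lemma IsSelfSimilar.dist_tauWord (hS : S.IsSelfSimilar r) (I : List (Fin N))
    (x y : EuclideanSpace ℝ (Fin d)) :
    dist (S.tauWord I x) (S.tauWord I y) = r ^ I.length * dist x y := by
  induction I with
  | nil => simp [tauWord]
  | cons i I ih => simp [tauWord, hS.dist_tau, ih, pow_succ']; ring

lemma continuous_tau (S : AffineIFS d N) (i : Fin N) : Continuous (S.tau i) :=
  (LinearMap.continuous_of_finiteDimensional _).comp (continuous_id.add continuous_const)

lemma continuous_tauWord (S : AffineIFS d N) (I : List (Fin N)) : Continuous (S.tauWord I) := by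
  induction I with
  | nil => exact continuous_id
  | cons i I ih => exact (S.continuous_tau i).comp ih

lemma measurable_tau (S : AffineIFS d N) (i : Fin N) : Measurable (S.tau i) :=
  (S.continuous_tau i).measurable

lemma IsSelfSimilar.injective_tau (hS : S.IsSelfSimilar r) (i : Fin N) :
    Function.Injective (S.tau i) := by
  intro x y h
  have := hS.dist_tau i x y
  rw [h, dist_self] at this
  exact dist_eq_zero.1 ((mul_eq_zero.1 this.symm).resolve_left hS.1.ne')

lemma IsSelfSimilar.injective_tauWord (hS : S.IsSelfSimilar r) (I : List (Fin N)) :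
    Function.Injective (S.tauWord I) := by
  induction I with
  | nil => exact Function.injective_id
  | cons i I ih => exact (hS.injective_tau i).comp ih

lemma IsSelfSimilar.measurableEmbedding_tauWord (hS : S.IsSelfSimilar r) (I : List (Fin N)) :
    MeasurableEmbedding (S.tauWord I) :=
  (S.continuous_tauWord I).measurableEmbedding (hS.injective_tauWord I)

lemma IsSelfSimilar.volume_image_tau (hS : S.IsSelfSimilar r) (i : Fin N)
    (E : Set (EuclideanSpace ℝ (Fin d))) :
    volume (S.tau i '' E) = ENNReal.ofReal (r ^ d) * volume E := by
  have : S.tau i '' E = Matrix.toEuclideanLin S.R⁻¹ '' ((fun x => x + S.b i) '' E) := by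
    rw [Set.image_image]; rfl
  rw [this, Measure.addHaar_image_linearMap, hS.abs_det, Set.image_add_right,
    measure_preimage_add_right]

lemma IsSelfSimilar.volume_image_tauWord (hS : S.IsSelfSimilar r) (I : List (Fin N))
    (E : Set (EuclideanSpace ℝ (Fin d))) :
    volume (S.tauWord I '' E) = ENNReal.ofReal (r ^ d) ^ I.length * volume E := by
  induction I with
  | nil => simp [tauWord]
  | cons i I ih =>
    rw [tauWord, Set.image_comp, hS.volume_image_tau, ih, List.length_cons, pow_succ', mul_assoc]

lemma IsAttractor.mapsTo_tau (hX : S.IsAttractor X) (i : Fin N) {x} (hx : x ∈ X) :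
    S.tau i x ∈ X := by
  rw [hX.eq_iUnion]
  exact Set.mem_iUnion.2 ⟨i, x, hx, rfl⟩

lemma IsAttractor.exists_mem_image_tauWord (hX : S.IsAttractor X) (n : ℕ) {x} (hx : x ∈ X) :
    ∃ J : List (Fin N), J.length = n ∧ x ∈ S.tauWord J '' X := by
  induction n generalizing x with
  | zero => exact ⟨[], rfl, by simpa [tauWord] using hx⟩
  | succ n ih =>
    rw [hX.eq_iUnion] at hx
    obtain ⟨i, y, hy, rfl⟩ := Set.mem_iUnion.1 hx
    obtain ⟨J, hJ, z, hz, rfl⟩ := ih hy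
    exact ⟨i :: J, by simp [hJ], z, hz, rfl⟩

/-! ### Mass of cylinders and concentration on the attractor. -/

lemma ofReal_weight_mul_le (hμ : S.IsInvariantMeasure μ) (I : List (Fin N))
    {E : Set (EuclideanSpace ℝ (Fin d))} (hE : MeasurableSet E) :
    ENNReal.ofReal (S.weight I) * μ (S.tauWord I ⁻¹' E) ≤ μ E := by
  induction I generalizing E with
  | nil => simp [weight_nil, tauWord]
  | cons i I ih =>
    rw [weight_cons, ENNReal.ofReal_mul (S.p_pos i).le, mul_assoc, tauWord, Set.preimage_comp,
      hμ.apply_eq_sum E hE]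
    refine (mul_le_mul_right (ih (S.measurable_tau i hE)) _).trans ?_
    -- Only the term of the first letter is kept; overlapping cylinders may supply more mass, hence
    -- an inequality.
    exact Finset.single_le_sum
      (f := fun i => ENNReal.ofReal (S.p i) * μ (S.tau i ⁻¹' E)) (fun _ _ => zero_le)
      (Finset.mem_univ i)

lemma ofReal_weight_mul_le_measure_image (hS : S.IsSelfSimilar r) (hμ : S.IsInvariantMeasure μ)
    (I : List (Fin N)) {E : Set (EuclideanSpace ℝ (Fin d))} (hE : MeasurableSet E) :
    ENNReal.ofReal (S.weight I) * μ E ≤ μ (S.tauWord I '' E) := by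
  have := ofReal_weight_mul_le hμ I ((hS.measurableEmbedding_tauWord I).measurableSet_image' hE)
  rwa [Set.preimage_image_eq _ (hS.injective_tauWord I)] at this

/-- The invariant measure is concentrated on the attractor. -/
lemma measure_compl_attractor (hS : S.IsSelfSimilar r) (hX : S.IsAttractor X)
    (hμ : S.IsInvariantMeasure μ) : μ Xᶜ = 0 := by
  have := hμ.isProbabilityMeasure
  have hmeas : ∀ t, MeasurableSet {x | t < Metric.infDist x X} := fun t =>
    measurableSet_lt measurable_const (Metric.continuous_infDist_pt X).measurable
  -- Since `τ_i` maps `X` into itself and contracts by `r`, a point `x` with `τ_i x` farther than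
  -- `t` from `X` is itself farther than `t / r`. Iterating pushes the tail to infinity, where a
  -- finite measure vanishes.
  have hstep : ∀ t, μ {x | t < Metric.infDist x X} ≤ μ {x | t / r < Metric.infDist x X} := by
    intro t
    rw [hμ.apply_eq_sum _ (hmeas t)]
    calc _ ≤ ∑ i, ENNReal.ofReal (S.p i) * μ {x | t / r < Metric.infDist x X} := by
          refine Finset.sum_le_sum fun i _ => mul_le_mul_right (measure_mono fun x hx => ?_) _
          obtain ⟨y, hy, hxy⟩ := hX.isCompact.exists_infDist_eq_dist hX.nonempty x
          have h1 : t < Metric.infDist (S.tau i x) X := hx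
          have h2 := Metric.infDist_le_dist_of_mem (x := S.tau i x) (hX.mapsTo_tau i hy)
          rw [hS.dist_tau, ← hxy] at h2
          show t / r < _
          rw [div_lt_iff₀' hS.1]
          exact h1.trans_le h2
      _ = _ := by
          rw [← Finset.sum_mul, ← ENNReal.ofReal_sum_of_nonneg (fun i _ => (S.p_pos i).le),
            S.p_sum, ENNReal.ofReal_one, one_mul]
  have hiter : ∀ (k : ℕ) t, μ {x | t < Metric.infDist x X} ≤
      μ {x | t / r ^ k < Metric.infDist x X} := by
    intro k
    induction k with
    | zero => intro t; simp
    | succ k ih =>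
      intro t
      refine (ih t).trans ((hstep _).trans_eq ?_)
      rw [div_div, pow_succ]
  have hzero : ∀ t, 0 < t → μ {x | t < Metric.infDist x X} = 0 := by
    intro t ht
    have hanti : Antitone fun k : ℕ => {x | t / r ^ k < Metric.infDist x X} := by
      intro k l hkl x hx
      refine lt_of_le_of_lt (b := t / r ^ l) ?_ hx
      have h1 := hS.1
      have := pow_le_pow_of_le_one hS.1.le hS.2.1.le hkl
      gcongr
    have hlim := tendsto_measure_iInter_atTop (μ := μ)
      (fun k : ℕ => (hmeas (t / r ^ k)).nullMeasurableSet) hanti ⟨0, measure_ne_top _ _⟩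
    have hempty : ⋂ k : ℕ, {x | t / r ^ k < Metric.infDist x X} = ∅ := by
      refine Set.eq_empty_of_forall_notMem fun x hx => ?_
      simp only [Set.mem_iInter, Set.mem_ofPred_eq] at hx
      obtain ⟨k, hk⟩ := exists_pow_lt_of_lt_one
        (div_pos ht (show 0 < Metric.infDist x X + 1 by
          have := Metric.infDist_nonneg (x := x) (s := X); linarith)) hS.2.1
      have h1 := hx k
      have h2 := pow_pos hS.1 k
      have h3 := Metric.infDist_nonneg (x := x) (s := X)
      rw [div_lt_iff₀ h2] at h1
      rw [lt_div_iff₀ (by linarith)] at hk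
      nlinarith
    rw [hempty, measure_empty] at hlim
    exact le_antisymm (ge_of_tendsto' hlim fun k => hiter k t) zero_le
  have hcover : Xᶜ ⊆ ⋃ k : ℕ, {x | 1 / ((k : ℝ) + 1) < Metric.infDist x X} := by
    intro x hx
    have := (hX.isCompact.isClosed.notMem_iff_infDist_pos hX.nonempty).1 hx
    obtain ⟨k, hk⟩ := exists_nat_one_div_lt this
    exact Set.mem_iUnion.2 ⟨k, hk⟩
  refine measure_mono_null hcover (measure_iUnion_null fun k => hzero _ (by positivity))

/-- If `E` meets no cylinder of level `I.length` other than that of `I`, only the word `I`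
contributes to the mass of `E`. -/
lemma measure_eq_weight_mul_of_disjoint (hS : S.IsSelfSimilar r) (hX : S.IsAttractor X)
    (hμ : S.IsInvariantMeasure μ) (I : List (Fin N)) {E : Set (EuclideanSpace ℝ (Fin d))}
    (hE : MeasurableSet E)
    (hJ : ∀ J : List (Fin N), J.length = I.length → J ≠ I → Disjoint E (S.tauWord J '' X)) :
    μ E = ENNReal.ofReal (S.weight I) * μ (S.tauWord I ⁻¹' E) := by
  induction I generalizing E with
  | nil => simp [weight_nil, tauWord]
  | cons i I ih =>
    rw [hμ.apply_eq_sum E hE, Finset.sum_eq_single i, weight_cons,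
      ENNReal.ofReal_mul (S.p_pos i).le, mul_assoc, tauWord, Set.preimage_comp, ih]
    · exact S.measurable_tau i hE
    · intro J hJl hJI
      rw [Set.disjoint_left]
      rintro y hy ⟨z, hz, rfl⟩
      exact Set.disjoint_left.1 (hJ (i :: J) (by simp [hJl]) (by simpa using hJI)) hy ⟨z, hz, rfl⟩
    -- For another first letter `j`, every cylinder below `j` misses `E`, so `τ_j⁻¹ E` misses `X`
    -- and is null.
    · intro j _ hji
      refine mul_eq_zero_of_right _ (measure_mono_null ?_ (measure_compl_attractor hS hX hμ))
      intro y hy hyX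
      obtain ⟨J, hJl, z, hz, rfl⟩ := hX.exists_mem_image_tauWord I.length hyX
      exact Set.disjoint_left.1 (hJ (j :: J) (by simp [hJl]) (by simp [hji])) hy ⟨z, hz, rfl⟩
    · simp

/-! ### Uniqueness of the invariant measure via characteristic functions. -/

lemma IsInvariantMeasure.eq_sum_smul_map (hμ : S.IsInvariantMeasure μ) :
    μ = ∑ i, ENNReal.ofReal (S.p i) • μ.map (S.tau i) := by
  ext E hE
  rw [hμ.apply_eq_sum E hE]
  simp [Measure.finsetSum_apply, Measure.map_apply (S.measurable_tau _) hE]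

/-- All `τ_i` share the linear part `R⁻¹` and differ only by the translation `τ_i 0`, so each
pushforward contributes the same value of `charFun μ` up to a phase. -/
lemma IsInvariantMeasure.charFun_eq (hμ : S.IsInvariantMeasure μ)
    (t : EuclideanSpace ℝ (Fin d)) :
    charFun μ t = ∑ i, (S.p i : ℂ) *
      (Complex.exp (inner ℝ (S.tau i 0) t * Complex.I) *
        charFun μ ((Matrix.toEuclideanLin S.R⁻¹).adjoint t)) := by
  have := hμ.isProbabilityMeasure
  conv_lhs => rw [hμ.eq_sum_smul_map]
  have hint : ∀ (ρ : Measure (EuclideanSpace ℝ (Fin d))) [IsFiniteMeasure ρ],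
      Integrable (fun x => Complex.exp ((inner ℝ x t : ℝ) * Complex.I)) ρ := fun ρ _ =>
    (integrable_const (1 : ℝ)).mono' (by fun_prop) (by simp [Complex.norm_exp_ofReal_mul_I])
  have hfin : ∀ i, IsFiniteMeasure (μ.map (S.tau i)) := fun i => inferInstance
  rw [charFun_apply, integral_finsetSum_measure]
  · refine Finset.sum_congr rfl fun i _ => ?_
    rw [integral_smul_measure, ENNReal.toReal_ofReal (S.p_pos i).le,
      integral_map (S.measurable_tau i).aemeasurable (by fun_prop), charFun_apply,
      ← integral_const_mul, Complex.real_smul]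
    congr 2
    ext x
    rw [← Complex.exp_add, LinearMap.adjoint_inner_right, ← add_mul, ← Complex.ofReal_add,
      ← inner_add_left]
    simp [tau, add_comm]
  · intro i _
    exact (hint (μ.map (S.tau i))).smul_measure ENNReal.ofReal_ne_top

lemma IsSelfSimilar.norm_adjoint_le (hS : S.IsSelfSimilar r) (t : EuclideanSpace ℝ (Fin d)) :
    ‖(Matrix.toEuclideanLin S.R⁻¹).adjoint t‖ ≤ r * ‖t‖ := by
  set A := Matrix.toEuclideanLin S.R⁻¹
  have h1 : ‖A.adjoint t‖ ^ 2 ≤ r * ‖A.adjoint t‖ * ‖t‖ := by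
    rw [← real_inner_self_eq_norm_sq, LinearMap.adjoint_inner_right, ← hS.norm_toEuclideanLin]
    exact real_inner_le_norm _ _
  rcases (norm_nonneg (A.adjoint t)).eq_or_lt with h | h
  · rw [← h]; exact mul_nonneg hS.1.le (norm_nonneg _)
  · nlinarith

/-- The phases are unimodular and the weights sum to `1`, so the difference of the characteristic
functions at `t` is at most that at `A t`. The iterates `A^[k] t` tend to `0`, where both functions
equal `1`. -/
lemma IsInvariantMeasure.unique (hS : S.IsSelfSimilar r)
    {μ ρ : Measure (EuclideanSpace ℝ (Fin d))} (hμ : S.IsInvariantMeasure μ)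
    (hρ : S.IsInvariantMeasure ρ) : μ = ρ := by
  have := hμ.isProbabilityMeasure
  have := hρ.isProbabilityMeasure
  set A := (Matrix.toEuclideanLin S.R⁻¹).adjoint
  refine Measure.ext_of_charFun (funext fun t => ?_)
  have hstep : ∀ t, ‖charFun μ t - charFun ρ t‖ ≤ ‖charFun μ (A t) - charFun ρ (A t)‖ := by
    intro t
    rw [hμ.charFun_eq, hρ.charFun_eq, ← Finset.sum_sub_distrib]
    refine (norm_sum_le _ _).trans_eq ?_
    simp_rw [← mul_sub, norm_mul, Complex.norm_exp_ofReal_mul_I, one_mul,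
      Complex.norm_of_nonneg (S.p_pos _).le, ← Finset.sum_mul]
    rw [S.p_sum, one_mul]
  have hiter : ∀ k : ℕ, ‖charFun μ t - charFun ρ t‖ ≤
      ‖charFun μ (A^[k] t) - charFun ρ (A^[k] t)‖ := by
    intro k
    induction k with
    | zero => simp
    | succ k ih => rw [Function.iterate_succ_apply']; exact ih.trans (hstep _)
  have hnorm : ∀ k : ℕ, ‖A^[k] t‖ ≤ r ^ k * ‖t‖ := by
    intro k
    induction k with
    | zero => simp
    | succ k ih =>
      rw [Function.iterate_succ_apply', pow_succ', mul_assoc]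
      exact (hS.norm_adjoint_le _).trans (mul_le_mul_of_nonneg_left ih hS.1.le)
  have hlim : Filter.Tendsto (fun k => A^[k] t) Filter.atTop (nhds 0) := by
    refine squeeze_zero_norm hnorm ?_
    simpa using (tendsto_pow_atTop_nhds_zero_of_lt_one hS.1.le hS.2.1).mul_const ‖t‖
  have hcont : Continuous fun t => ‖charFun μ t - charFun ρ t‖ :=
    (continuous_charFun.sub continuous_charFun).norm
  have h0 := (hcont.tendsto 0).comp hlim
  have h1 := ge_of_tendsto' h0 hiter
  simpa [sub_eq_zero] using h1

end AffineIFS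

/-! ### Frame measures and two-sided bounds on the density. -/

section FrameDensity

variable {d : ℕ} {g : EuclideanSpace ℝ (Fin d) → ENNReal}

lemma fourierTransformMeasure_withDensity (hg : Measurable g) (hfin : ∀ᵐ x, g x < ⊤)
    (f : EuclideanSpace ℝ (Fin d) → ℂ) (t : EuclideanSpace ℝ (Fin d)) :
    fourierTransformMeasure (volume.withDensity g) f t =
      ∫ x, Real.fourierChar (-(inner ℝ x t)) • ((g x).toReal • f x) := by
  rw [fourierTransformMeasure, VectorFourier.fourierIntegral,
    integral_withDensity_eq_integral_toReal_smul hg hfin]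
  refine integral_congr_ae (Filter.Eventually.of_forall fun x => ?_)
  simp only [innerₗ_apply_apply]
  exact smul_comm _ _ _

/-- Translating the absolutely continuous complex measure `f dμ` does not change the modulus of
its Fourier transform. -/
lemma norm_fourierTransformMeasure_eq_of_translate (hg : Measurable g) (hfin : ∀ᵐ x, g x < ⊤)
    {f₁ f₂ : EuclideanSpace ℝ (Fin d) → ℂ} (a : EuclideanSpace ℝ (Fin d))
    (h : ∀ x, (g (x + a)).toReal • f₂ (x + a) = (g x).toReal • f₁ x)
    (t : EuclideanSpace ℝ (Fin d)) :
    ‖fourierTransformMeasure (volume.withDensity g) f₁ t‖ =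
      ‖fourierTransformMeasure (volume.withDensity g) f₂ t‖ := by
  rw [fourierTransformMeasure_withDensity hg hfin, fourierTransformMeasure_withDensity hg hfin,
    ← integral_add_right_eq_self
      (fun x => Real.fourierChar (-(inner ℝ x t)) • ((g x).toReal • f₂ x)) a]
  simp_rw [h, inner_add_left, neg_add, AddChar.map_add_eq_mul, mul_comm (Real.fourierChar _)
    (Real.fourierChar (-(inner ℝ a t))), mul_smul]
  simp_rw [Circle.smul_def (Real.fourierChar (-(inner ℝ a t)))]
  rw [integral_smul, norm_smul, Circle.norm_coe, one_mul]

lemma eLpNorm_two_sq {α F : Type*} [MeasurableSpace α] [NormedAddCommGroup F] (μ : Measure α)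
    (f : α → F) : eLpNorm f 2 μ ^ 2 = ∫⁻ x, ‖f x‖ₑ ^ 2 ∂μ := by
  have := eLpNorm_nnreal_pow_eq_lintegral (f := f) (μ := μ) (p := 2) (by norm_num)
  simpa using this

/-- If `g dx` has a frame measure with bounds `A`, `B`, then `A g(x + a) ≤ B g(x)` for almost
every `x` with `g(x)` and `g(x + a)` positive. -/
lemma ae_frame_bound_translate (hg : Measurable g) [IsFiniteMeasure (volume.withDensity g)]
    {ν : Measure (EuclideanSpace ℝ (Fin d))} {A B : ℝ}
    (hlow : ∀ f, MemLp f 2 (volume.withDensity g) →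
      ENNReal.ofReal A * eLpNorm f 2 (volume.withDensity g) ^ 2 ≤
        eLpNorm (fourierTransformMeasure (volume.withDensity g) f) 2 ν ^ 2)
    (hupp : ∀ f, MemLp f 2 (volume.withDensity g) →
      eLpNorm (fourierTransformMeasure (volume.withDensity g) f) 2 ν ^ 2 ≤
        ENNReal.ofReal B * eLpNorm f 2 (volume.withDensity g) ^ 2)
    (a : EuclideanSpace ℝ (Fin d)) :
    ∀ᵐ x, 0 < g x → 0 < g (x + a) →
      ENNReal.ofReal A * g (x + a) ≤ ENNReal.ofReal B * g x := by
  have hfin : ∀ᵐ x, g x < ⊤ := by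
    refine ae_lt_top hg ?_
    rw [← setLIntegral_univ, ← withDensity_apply _ MeasurableSet.univ]
    exact measure_ne_top _ _
  have hfina : ∀ᵐ x, g (x + a) < ⊤ :=
    (measurePreserving_add_right volume a).quasiMeasurePreserving.ae hfin
  have hga : Measurable fun x => g (x + a) := hg.comp (measurable_add_const a)
  -- The bad set, truncated at height `k` so that the test functions below are bounded and hence in
  -- `L²`.
  let W : ℕ → Set (EuclideanSpace ℝ (Fin d)) := fun k => {x | (0 < g x ∧ g x ≤ k) ∧
    (0 < g (x + a) ∧ g (x + a) ≤ k) ∧ ENNReal.ofReal B * g x < ENNReal.ofReal A * g (x + a)}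
  have hW : ∀ k, MeasurableSet (W k) := fun k =>
    ((measurableSet_lt measurable_const hg).inter (measurableSet_le hg measurable_const)).inter
      (((measurableSet_lt measurable_const hga).inter
        (measurableSet_le hga measurable_const)).inter
        (measurableSet_lt (hg.const_mul _) (hga.const_mul _)))
  have hnull : ∀ k, volume (W k) = 0 := by
    intro k
    by_contra hk
    -- Chosen so that `g f₁` and the translate by `a` of `g f₂` both equal `g x * g (x + a)` on `W
    -- k` and vanish elsewhere.
    let f₁ : EuclideanSpace ℝ (Fin d) → ℂ :=
      (W k).indicator fun x => ((g (x + a)).toReal : ℂ)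
    let f₂ : EuclideanSpace ℝ (Fin d) → ℂ :=
      fun x => (W k).indicator (fun y => ((g y).toReal : ℂ)) (x - a)
    have hf₁m : Measurable f₁ :=
      (Complex.measurable_ofReal.comp hga.ennreal_toReal).indicator (hW k)
    have hf₂m : Measurable f₂ :=
      ((Complex.measurable_ofReal.comp hg.ennreal_toReal).indicator (hW k)).comp
        (measurable_sub_const a)
    have hbd : ∀ y : ENNReal, y ≤ k → ‖(y.toReal : ℂ)‖ ≤ k := fun y hy => by
      rw [Complex.norm_of_nonneg ENNReal.toReal_nonneg]
      exact ENNReal.toReal_le_of_le_ofReal (Nat.cast_nonneg k) (by simpa using hy)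
    have hf₁ : MemLp f₁ 2 (volume.withDensity g) := by
      refine MemLp.of_bound hf₁m.aestronglyMeasurable k (Filter.Eventually.of_forall fun x => ?_)
      by_cases hx : x ∈ W k
      · simpa only [f₁, Set.indicator_of_mem hx] using hbd _ hx.2.1.2
      · simp [f₁, Set.indicator_of_notMem hx]
    have hf₂ : MemLp f₂ 2 (volume.withDensity g) := by
      refine MemLp.of_bound hf₂m.aestronglyMeasurable k (Filter.Eventually.of_forall fun x => ?_)
      by_cases hx : x - a ∈ W k
      · simpa only [f₂, Set.indicator_of_mem hx] using hbd _ hx.1.2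
      · simp [f₂, Set.indicator_of_notMem hx]
    have htrans : ∀ x, (g (x + a)).toReal • f₂ (x + a) = (g x).toReal • f₁ x := by
      intro x
      by_cases hx : x ∈ W k
      · simp [f₁, f₂, hx, mul_comm]
      · simp [f₁, f₂, hx]
    have hF : eLpNorm (fourierTransformMeasure (volume.withDensity g) f₁) 2 ν =
        eLpNorm (fourierTransformMeasure (volume.withDensity g) f₂) 2 ν :=
      eLpNorm_congr_norm_ae (Filter.Eventually.of_forall
        (norm_fourierTransformMeasure_eq_of_translate hg hfin a htrans))
    have hen : ∀ y : ENNReal, y ≤ k → ‖(y.toReal : ℂ)‖ₑ = y := fun y hy => by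
      rw [← ofReal_norm, Complex.norm_of_nonneg ENNReal.toReal_nonneg,
        ENNReal.ofReal_toReal (ne_top_of_le_ne_top (ENNReal.natCast_ne_top k) hy)]
    have hn₁ : eLpNorm f₁ 2 (volume.withDensity g) ^ 2 =
        ∫⁻ x in W k, g x * g (x + a) ^ 2 := by
      rw [eLpNorm_two_sq, lintegral_withDensity_eq_lintegral_mul _ hg (by fun_prop),
        ← lintegral_indicator (hW k)]
      refine lintegral_congr fun x => ?_
      by_cases hx : x ∈ W k
      · simp only [Pi.mul_apply, f₁, Set.indicator_of_mem hx, hen _ hx.2.1.2]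
      · simp [f₁, Set.indicator_of_notMem hx]
    have hn₂ : eLpNorm f₂ 2 (volume.withDensity g) ^ 2 =
        ∫⁻ x in W k, g (x + a) * g x ^ 2 := by
      rw [eLpNorm_two_sq, lintegral_withDensity_eq_lintegral_mul _ hg (by fun_prop),
        ← lintegral_indicator (hW k),
        ← lintegral_add_right_eq_self _ a]
      refine lintegral_congr fun x => ?_
      by_cases hx : x ∈ W k
      · simp only [Pi.mul_apply, f₂, add_sub_cancel_right, Set.indicator_of_mem hx, hen _ hx.1.2]
      · simp [f₂, Set.indicator_of_notMem hx]
    have hle := (hlow f₁ hf₁).trans ((congrArg (· ^ 2) hF).trans_le (hupp f₂ hf₂))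
    have hfin₂ : ENNReal.ofReal B * eLpNorm f₂ 2 (volume.withDensity g) ^ 2 ≠ ⊤ :=
      ENNReal.mul_ne_top ENNReal.ofReal_ne_top (ENNReal.pow_ne_top hf₂.2.ne)
    rw [hn₁, hn₂, ← lintegral_const_mul _ (by fun_prop), ← lintegral_const_mul _ (by fun_prop)]
      at hle
    rw [hn₂, ← lintegral_const_mul _ (by fun_prop)] at hfin₂
    -- The frame bounds compare the integrals over `W k` of `g x * g (x + a)` times `A g (x + a)`
    -- and times `B g x`. On `W k` the first integrand is strictly larger, so positive volume is
    -- impossible.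
    refine absurd hle (not_le.2 (setLIntegral_strict_mono (hW k) hk (by fun_prop) hfin₂
      (Filter.Eventually.of_forall fun x hx => ?_)))
    have h1 : g x * g (x + a) ≠ 0 := mul_ne_zero hx.1.1.ne' hx.2.1.1.ne'
    have h2 : g x * g (x + a) ≠ ⊤ := ENNReal.mul_ne_top
      (ne_top_of_le_ne_top (ENNReal.natCast_ne_top k) hx.1.2)
      (ne_top_of_le_ne_top (ENNReal.natCast_ne_top k) hx.2.1.2)
    calc _ = g x * g (x + a) * (ENNReal.ofReal B * g x) := by ring
      _ < g x * g (x + a) * (ENNReal.ofReal A * g (x + a)) :=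
          (ENNReal.mul_lt_mul_iff_right h1 h2).2 hx.2.2
      _ = _ := by ring
  have hall : ∀ᵐ x, ∀ k, x ∉ W k := ae_all_iff.2 fun k => measure_eq_zero_iff_ae_notMem.1 (hnull k)
  filter_upwards [hall, hfin, hfina] with x hx hx1 hx2 hp hpa
  by_contra hcon
  obtain ⟨k, hk⟩ := ENNReal.exists_nat_gt (max_lt hx1 hx2).ne
  exact hx k ⟨⟨hp, (le_max_left _ _).trans hk.le⟩, ⟨hpa, (le_max_right _ _).trans hk.le⟩,
    not_le.1 hcon⟩

/-- The density of an absolutely continuous measure with a frame measure is bounded above and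
away from zero on the set where it does not vanish. -/
lemma exists_bounds_of_isFrameMeasure (hg : Measurable g)
    [IsProbabilityMeasure (volume.withDensity g)] {ν : Measure (EuclideanSpace ℝ (Fin d))}
    (hν : IsFrameMeasure ν (volume.withDensity g)) :
    ∃ m M : ENNReal, m ≠ 0 ∧ M ≠ ⊤ ∧ ∀ᵐ x, 0 < g x → m ≤ g x ∧ g x ≤ M := by
  obtain ⟨A, B, hA, hB, hf⟩ := hν
  have htrans := ae_frame_bound_translate hg (fun f h => (hf f h).1) (fun f h => (hf f h).2)
  have hmeas : MeasurableSet {z : EuclideanSpace ℝ (Fin d) × EuclideanSpace ℝ (Fin d) |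
      0 < g z.1 → 0 < g z.2 → ENNReal.ofReal A * g z.2 ≤ ENNReal.ofReal B * g z.1} := by
    have h1 : Measurable fun z : EuclideanSpace ℝ (Fin d) × EuclideanSpace ℝ (Fin d) => g z.1 :=
      hg.comp measurable_fst
    have h2 : Measurable fun z : EuclideanSpace ℝ (Fin d) × EuclideanSpace ℝ (Fin d) => g z.2 :=
      hg.comp measurable_snd
    exact (measurableSet_lt measurable_const h1).imp ((measurableSet_lt measurable_const h2).imp
      (measurableSet_le (h2.const_mul _) (h1.const_mul _)))
  have hxy : ∀ᵐ x, ∀ᵐ y, 0 < g x → 0 < g y →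
      ENNReal.ofReal A * g y ≤ ENNReal.ofReal B * g x := by
    -- The exceptional null set depends on `a`; the shear `(x, a) ↦ (x, x + a)` and Fubini turn this
    -- into a statement for almost every pair of points.
    have hshear : Measurable fun z : EuclideanSpace ℝ (Fin d) × EuclideanSpace ℝ (Fin d) =>
      (z.1, z.1 + z.2) := by fun_prop
    have h := (Measure.ae_ae_comm (μ := volume) (ν := volume)
      (p := fun x a => 0 < g x → 0 < g (x + a) →
        ENNReal.ofReal A * g (x + a) ≤ ENNReal.ofReal B * g x) (hshear hmeas)).2
      (Filter.Eventually.of_forall htrans)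
    filter_upwards [h] with x hx
    have := (measurePreserving_add_left volume (-x)).quasiMeasurePreserving.ae hx
    simpa using this
  have hyx := (Measure.ae_ae_comm (μ := volume) (ν := volume)
    (p := fun x y => 0 < g x → 0 < g y → ENNReal.ofReal A * g y ≤ ENNReal.ofReal B * g x)
    hmeas).1 hxy
  have hfin : ∀ᵐ x, g x < ⊤ := by
    refine ae_lt_top hg ?_
    rw [← setLIntegral_univ, ← withDensity_apply _ MeasurableSet.univ]
    exact measure_ne_top _ _
  have hex : ∃ᵐ x, 0 < g x := by
    intro h
    have h0 : volume.withDensity g = 0 := by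
      rw [withDensity_eq_zero_iff hg.aemeasurable]
      filter_upwards [h] with x hx
      simpa using hx
    exact IsProbabilityMeasure.ne_zero (volume.withDensity g) h0
  -- A generic reference point: comparing `g y` with `g x₀` in both directions yields the bounds `A
  -- g x₀ / B` and `B g x₀ / A`.
  obtain ⟨x₀, hx₀, h1, h2, h3⟩ := (hex.and_eventually (hxy.and (hyx.and hfin))).exists
  have hA' : ENNReal.ofReal A ≠ 0 := by simpa using hA
  have hB' : ENNReal.ofReal B ≠ 0 := by simpa using hB
  refine ⟨ENNReal.ofReal A * g x₀ / ENNReal.ofReal B, ENNReal.ofReal B * g x₀ / ENNReal.ofReal A,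
    (ENNReal.div_pos (mul_ne_zero hA' hx₀.ne') ENNReal.ofReal_ne_top).ne',
    (ENNReal.div_lt_top (ENNReal.mul_ne_top ENNReal.ofReal_ne_top h3.ne) hA').ne, ?_⟩
  filter_upwards [h1, h2] with y hy1 hy2 hy
  exact ⟨ENNReal.div_le_of_le_mul' (hy2 hy hx₀),
    (ENNReal.le_div_iff_mul_le (Or.inl hA') (Or.inl ENNReal.ofReal_ne_top)).2
      (by rw [mul_comm]; exact hy1 hx₀ hy)⟩

end FrameDensity

/-! ### Comparing weights with volume contraction. -/

/-- If `a ^ k * c ≤ b ^ k * C` for all `k` with `c > 0` and `C < ∞`, then `a ≤ b`. -/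
lemma le_of_forall_pow_mul_le {a b : ℝ} (ha : 0 ≤ a) (hb : 0 < b) {c C : ENNReal}
    (hc : c ≠ 0) (hC : C ≠ ⊤)
    (h : ∀ k : ℕ, ENNReal.ofReal a ^ k * c ≤ ENNReal.ofReal b ^ k * C) : a ≤ b := by
  by_contra! hlt
  have hcT : c ≠ ⊤ := ne_top_of_le_ne_top hC (by simpa using h 0)
  have hc' : 0 < c.toReal := ENNReal.toReal_pos hc hcT
  obtain ⟨k, hk⟩ := pow_unbounded_of_one_lt (C.toReal / c.toReal) ((one_lt_div hb).2 hlt)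
  have h1 := ENNReal.toReal_mono (ENNReal.mul_ne_top (ENNReal.pow_ne_top ENNReal.ofReal_ne_top) hC)
    (h k)
  simp only [ENNReal.toReal_mul, ENNReal.toReal_pow, ENNReal.toReal_ofReal ha,
    ENNReal.toReal_ofReal hb.le] at h1
  rw [div_pow, div_lt_div_iff₀ hc' (pow_pos hb k)] at hk
  linarith

namespace AffineIFS

variable {d N : ℕ} {S : AffineIFS d N} {r : ℝ} {X : Set (EuclideanSpace ℝ (Fin d))}
  {μ : Measure (EuclideanSpace ℝ (Fin d))}

lemma measure_attractor (hS : S.IsSelfSimilar r) (hX : S.IsAttractor X)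
    (hμ : S.IsInvariantMeasure μ) : μ X = 1 := by
  have := hμ.isProbabilityMeasure
  exact (prob_compl_eq_zero_iff hX.isCompact.measurableSet).1 (measure_compl_attractor hS hX hμ)

lemma iterate_image_tauWord (I : List (Fin N)) (E : Set (EuclideanSpace ℝ (Fin d))) (k : ℕ) :
    (S.tauWord I)^[k + 1] '' E = S.tauWord I '' ((S.tauWord I)^[k] '' E) := by
  rw [Function.iterate_succ', Set.image_comp]

lemma measurableSet_iterate_image (hS : S.IsSelfSimilar r) (I : List (Fin N))
    {E : Set (EuclideanSpace ℝ (Fin d))} (hE : MeasurableSet E) (k : ℕ) :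
    MeasurableSet ((S.tauWord I)^[k] '' E) := by
  induction k with
  | zero => simpa
  | succ k ih =>
    rw [iterate_image_tauWord]
    exact (hS.measurableEmbedding_tauWord I).measurableSet_image' ih

lemma weight_pow_mul_le_measure_iterate (hS : S.IsSelfSimilar r) (hμ : S.IsInvariantMeasure μ)
    (I : List (Fin N)) {E : Set (EuclideanSpace ℝ (Fin d))} (hE : MeasurableSet E) (k : ℕ) :
    ENNReal.ofReal (S.weight I) ^ k * μ E ≤ μ ((S.tauWord I)^[k] '' E) := by
  induction k with
  | zero => simp
  | succ k ih =>
    rw [iterate_image_tauWord, pow_succ', mul_assoc]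
    exact (mul_le_mul_right ih _).trans
      (ofReal_weight_mul_le_measure_image hS hμ I (measurableSet_iterate_image hS I hE k))

lemma volume_iterate_image (hS : S.IsSelfSimilar r) (I : List (Fin N))
    (E : Set (EuclideanSpace ℝ (Fin d))) (k : ℕ) :
    volume ((S.tauWord I)^[k] '' E) =
      ENNReal.ofReal ((r ^ d) ^ I.length) ^ k * volume E := by
  induction k with
  | zero => simp
  | succ k ih =>
    rw [iterate_image_tauWord, hS.volume_image_tauWord, ih, pow_succ',
      ENNReal.ofReal_pow (pow_nonneg hS.1.le _), mul_assoc]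

/-- If the invariant measure has bounded density, then the weight of a word is at most the
volume contraction of its map. -/
lemma weight_le (hS : S.IsSelfSimilar r) (hX : S.IsAttractor X) (hμ : S.IsInvariantMeasure μ)
    {M : ENNReal} (hM : M ≠ ⊤) (hle : ∀ E, MeasurableSet E → μ E ≤ M * volume E)
    (I : List (Fin N)) : S.weight I ≤ (r ^ d) ^ I.length := by
  refine le_of_forall_pow_mul_le (S.weight_pos I).le (pow_pos (pow_pos hS.1 _) _)
    (c := μ X) (C := M * volume X) (by rw [measure_attractor hS hX hμ]; exact one_ne_zero)
    (ENNReal.mul_ne_top hM hX.isCompact.measure_lt_top.ne) fun k => ?_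
  have hXm := hX.isCompact.measurableSet
  calc _ ≤ μ ((S.tauWord I)^[k] '' X) := weight_pow_mul_le_measure_iterate hS hμ I hXm k
    _ ≤ M * volume ((S.tauWord I)^[k] '' X) := hle _ (measurableSet_iterate_image hS I hXm k)
    _ = _ := by rw [volume_iterate_image hS]; ring

lemma IsSelfSimilar.preimage_closedBall_tauWord (hS : S.IsSelfSimilar r) {I : List (Fin N)}
    {x : EuclideanSpace ℝ (Fin d)} (hx : S.tauWord I x = x) (ρ : ℝ) :
    S.tauWord I ⁻¹' Metric.closedBall x (r ^ I.length * ρ) = Metric.closedBall x ρ := by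
  ext y
  have h : dist (S.tauWord I y) x = r ^ I.length * dist y x := by
    conv_lhs => rw [← hx]
    exact hS.dist_tauWord I y x
  rw [Set.mem_preimage, Metric.mem_closedBall, Metric.mem_closedBall, h,
    mul_le_mul_iff_right₀ (pow_pos hS.1 _)]

/-- Every ball around the fixed point of a nonempty word has positive mass. -/
lemma measure_closedBall_pos (hS : S.IsSelfSimilar r) (hX : S.IsAttractor X)
    (hμ : S.IsInvariantMeasure μ) {I : List (Fin N)} (hI : I ≠ [])
    {x : EuclideanSpace ℝ (Fin d)} (hx : S.tauWord I x = x) {δ : ℝ} (hδ : 0 < δ) :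
    0 < μ (Metric.closedBall x δ) := by
  -- The iterates of `X` under `τ_I` lie in balls about `x` of radius tending to `0`, and each has
  -- positive mass.
  obtain ⟨C, hC⟩ := hX.isCompact.isBounded.subset_closedBall x
  have hiter : ∀ (k : ℕ) y, dist ((S.tauWord I)^[k] y) x = (r ^ I.length) ^ k * dist y x := by
    intro k y
    induction k with
    | zero => simp
    | succ k ih =>
      rw [Function.iterate_succ_apply', pow_succ', mul_assoc, ← ih]
      conv_lhs => rw [← hx]
      exact hS.dist_tauWord I _ x
  have hn : I.length ≠ 0 := by simpa using hI
  have hlim := (tendsto_pow_atTop_nhds_zero_of_lt_one (pow_nonneg hS.1.le I.length)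
    (pow_lt_one₀ hS.1.le hS.2.1 hn)).mul_const C
  rw [zero_mul] at hlim
  obtain ⟨k, hk⟩ := (hlim.eventually_le_const hδ).exists
  have hsub : (S.tauWord I)^[k] '' X ⊆ Metric.closedBall x δ := by
    rintro _ ⟨y, hy, rfl⟩
    rw [Metric.mem_closedBall, hiter]
    exact (mul_le_mul_of_nonneg_left (hC hy) (pow_nonneg (pow_nonneg hS.1.le _) _)).trans hk
  refine lt_of_lt_of_le ?_ ((weight_pow_mul_le_measure_iterate hS hμ I
    hX.isCompact.measurableSet k).trans (measure_mono hsub))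
  rw [measure_attractor hS hX hμ, mul_one]
  exact ENNReal.pow_pos (ENNReal.ofReal_pos.2 (S.weight_pos I)) k

/-- A fixed point that avoids the other cylinders of its level has a ball around it that avoids
them. -/
lemma exists_closedBall_disjoint (hX : S.IsAttractor X) {I : List (Fin N)}
    {x : EuclideanSpace ℝ (Fin d)}
    (hxJ : ∀ J : List (Fin N), J.length = I.length → J ≠ I → x ∉ S.tauWord J '' X) :
    ∃ δ > 0, ∀ J : List (Fin N), J.length = I.length → J ≠ I →
      Disjoint (Metric.closedBall x δ) (S.tauWord J '' X) := by
  have hfin : {J : List (Fin N) | J.length = I.length ∧ J ≠ I}.Finite :=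
    (List.finite_length_eq (Fin N) I.length).subset fun J hJ => hJ.1
  have hclosed : IsClosed (⋃ J ∈ {J : List (Fin N) | J.length = I.length ∧ J ≠ I},
      S.tauWord J '' X) :=
    hfin.isClosed_biUnion fun J _ => (hX.isCompact.image (S.continuous_tauWord J)).isClosed
  have hx : x ∉ ⋃ J ∈ {J : List (Fin N) | J.length = I.length ∧ J ≠ I}, S.tauWord J '' X := by
    simp only [Set.mem_iUnion, not_exists]
    exact fun J hJ => hxJ J hJ.1 hJ.2
  obtain ⟨δ, hδ, h⟩ := Metric.nhds_basis_closedBall.mem_iff.1 (hclosed.isOpen_compl.mem_nhds hx)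
  refine ⟨δ, hδ, fun J hJl hJI => ?_⟩
  exact (Set.disjoint_left.2 h).mono_right (Set.subset_biUnion_of_mem (u := fun J => S.tauWord J '' X)
    (show J ∈ {J : List (Fin N) | J.length = I.length ∧ J ≠ I} from ⟨hJl, hJI⟩))

/-- If the density of the invariant measure is bounded away from zero where it does not vanish,
then a word whose fixed point avoids the other cylinders of its level has weight at least the
volume contraction of its map. -/
lemma le_weight (hS : S.IsSelfSimilar r) (hX : S.IsAttractor X) (hμ : S.IsInvariantMeasure μ)
    {V : Set (EuclideanSpace ℝ (Fin d))} (hV : MeasurableSet V)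
    {m : ENNReal} (hm : m ≠ 0) (hac : μ ≪ volume.restrict V)
    (hle : ∀ E, MeasurableSet E → m * volume (E ∩ V) ≤ μ E)
    {I : List (Fin N)} (hI : I ≠ []) {x : EuclideanSpace ℝ (Fin d)} (hx : S.tauWord I x = x)
    (hxJ : ∀ J : List (Fin N), J.length = I.length → J ≠ I → x ∉ S.tauWord J '' X) :
    (r ^ d) ^ I.length ≤ S.weight I := by
  have := hμ.isProbabilityMeasure
  obtain ⟨δ, hδ, hdisj⟩ := exists_closedBall_disjoint hX hxJ
  set T := S.tauWord I
  set q := r ^ I.length with hq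
  have hq0 : 0 < q := pow_pos hS.1 _
  have hq1 : q ≤ 1 := pow_le_one₀ hS.1.le hS.2.1.le
  let U : ℕ → Set (EuclideanSpace ℝ (Fin d)) := fun k => Metric.closedBall x (q ^ k * δ)
  have hpre : ∀ k, T ⁻¹' U (k + 1) = U k := fun k => by
    simp only [U]
    rw [pow_succ', mul_assoc]
    exact hS.preimage_closedBall_tauWord hx _
  have hUm : ∀ k, MeasurableSet (U k) := fun k => Metric.isClosed_closedBall.measurableSet
  have hsub : ∀ k, U k ⊆ Metric.closedBall x δ := fun k =>
    Metric.closedBall_subset_closedBall (mul_le_of_le_one_left hδ.le (pow_le_one₀ hq0.le hq1))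
  have hmass : ∀ k, μ (U k) = ENNReal.ofReal (S.weight I) ^ k * μ (U 0) := by
    intro k
    induction k with
    | zero => simp
    | succ k ih =>
      rw [measure_eq_weight_mul_of_disjoint hS hX hμ I (hUm (k + 1))
        (fun J h1 h2 => (hdisj J h1 h2).mono_left (hsub _)), hpre, ih, pow_succ', mul_assoc]
  -- `μ` does not charge `T '' V \ V`, hence not its preimage under `T`. That preimage lies in `V`,
  -- where `μ` dominates `m` times volume, so it is Lebesgue null, and so is its image.
  have hnull : volume (T '' V \ V) = 0 := by
    have hF : MeasurableSet (T '' V \ V) :=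
      ((hS.measurableEmbedding_tauWord I).measurableSet_image' hV).diff hV
    have h1 : μ (T '' V \ V) = 0 := hac (by rw [Measure.restrict_apply hF]; simp)
    have h2 : μ (T ⁻¹' (T '' V \ V)) = 0 := by
      have := ofReal_weight_mul_le hμ I hF
      rw [h1, nonpos_iff_eq_zero, mul_eq_zero] at this
      exact this.resolve_left (ENNReal.ofReal_pos.2 (S.weight_pos I)).ne'
    have hTV : T ⁻¹' (T '' V \ V) ⊆ V := by
      rintro y ⟨⟨z, hz, hzy⟩, -⟩
      rwa [← hS.injective_tauWord I hzy]
    have h3 : volume (T ⁻¹' (T '' V \ V)) = 0 := by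
      have := hle _ ((S.continuous_tauWord I).measurable hF)
      rw [Set.inter_eq_left.2 hTV, h2, nonpos_iff_eq_zero, mul_eq_zero] at this
      exact this.resolve_left hm
    rw [← Set.image_preimage_eq_of_subset (f := T) (s := T '' V \ V)
      (Set.sdiff_subset.trans (Set.image_subset_range _ _)), hS.volume_image_tauWord, h3, mul_zero]
  -- `T` carries `U k ∩ V` into `U (k + 1) ∩ V` up to the null set of `hnull`.
  have hvol : ∀ k, ENNReal.ofReal ((r ^ d) ^ I.length) ^ k * volume (U 0 ∩ V) ≤
      volume (U k ∩ V) := by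
    intro k
    induction k with
    | zero => simp
    | succ k ih =>
      have h1 : T '' (U k ∩ V) ⊆ (U (k + 1) ∩ V) ∪ (T '' V \ V) := by
        rintro _ ⟨y, ⟨hyU, hyV⟩, rfl⟩
        by_cases h : T y ∈ V
        · exact Or.inl ⟨by rwa [← hpre] at hyU, h⟩
        · exact Or.inr ⟨⟨y, hyV, rfl⟩, h⟩
      calc _ = ENNReal.ofReal ((r ^ d) ^ I.length) *
              (ENNReal.ofReal ((r ^ d) ^ I.length) ^ k * volume (U 0 ∩ V)) := by
            rw [pow_succ', mul_assoc]
        _ ≤ ENNReal.ofReal ((r ^ d) ^ I.length) * volume (U k ∩ V) := mul_le_mul_right ih _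
        _ = volume (T '' (U k ∩ V)) := by
            rw [hS.volume_image_tauWord, ENNReal.ofReal_pow (pow_nonneg hS.1.le _)]
        _ ≤ volume (U (k + 1) ∩ V) + volume (T '' V \ V) :=
            (measure_mono h1).trans (measure_union_le _ _)
        _ = _ := by rw [hnull, add_zero]
  have hpos : volume (U 0 ∩ V) ≠ 0 := by
    intro h
    have h1 : μ (U 0) = 0 := hac (by rw [Measure.restrict_apply (hUm 0), h])
    have h2 := measure_closedBall_pos hS hX hμ hI hx hδ
    simp only [U, pow_zero, one_mul] at h1
    exact h2.ne' h1
  refine le_of_forall_pow_mul_le (pow_nonneg (pow_nonneg hS.1.le _) _) (S.weight_pos I)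
    (c := m * volume (U 0 ∩ V)) (C := μ (U 0)) (mul_ne_zero hm hpos) (measure_ne_top _ _)
    fun k => ?_
  calc _ = m * (ENNReal.ofReal ((r ^ d) ^ I.length) ^ k * volume (U 0 ∩ V)) := by ring
    _ ≤ m * volume (U k ∩ V) := mul_le_mul_right (hvol k) _
    _ ≤ μ (U k) := hle _ (hUm k)
    _ = _ := hmass k

/-- A product of factors at most `c` can reach `c ^ n` only if every factor equals `c`. -/
lemma p_eq_of_pow_le_weight {c : ℝ} (hc : 0 < c) (hle : ∀ i, S.p i ≤ c) {I : List (Fin N)}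
    (h : c ^ I.length ≤ S.weight I) : ∀ i ∈ I, S.p i = c := by
  have hw : ∀ J : List (Fin N), S.weight J ≤ c ^ J.length := by
    intro J
    induction J with
    | nil => simp [weight_nil]
    | cons j J ih =>
      rw [weight_cons, List.length_cons, pow_succ']
      exact mul_le_mul (hle j) ih (S.weight_pos J).le hc.le
  induction I with
  | nil => simp
  | cons i I ih =>
    rw [weight_cons, List.length_cons, pow_succ'] at h
    have h1 : c ≤ S.p i := le_of_mul_le_mul_right
      (h.trans (mul_le_mul_of_nonneg_left (hw I) (S.p_pos i).le)) (pow_pos hc _)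
    have h2 : c ^ I.length ≤ S.weight I := le_of_mul_le_mul_left
      (h.trans (mul_le_mul_of_nonneg_right (hle i) (S.weight_pos I).le)) hc
    intro j hj
    rcases List.mem_cons.1 hj with rfl | hj
    · exact le_antisymm (hle _) h1
    · exact ih h2 j hj

/-! ### The equality case: essentially disjoint pieces and normalized Lebesgue measure. -/

lemma IsAttractor.isClosed_image_tau (hX : S.IsAttractor X) (i : Fin N) :
    IsClosed (S.tau i '' X) :=
  (hX.isCompact.image (S.continuous_tau i)).isClosed

/-- If `N r ^ d = 1`, the indicator of the attractor is almost everywhere the sum of the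
indicators of its pieces. -/
lemma sum_indicator_image_tau_ae_eq (hS : S.IsSelfSimilar r) (hX : S.IsAttractor X)
    (hN : (N : ENNReal) * ENNReal.ofReal (r ^ d) = 1) :
    X.indicator (1 : EuclideanSpace ℝ (Fin d) → ENNReal) =ᵐ[volume]
      fun x => ∑ i, (S.tau i '' X).indicator (1 : EuclideanSpace ℝ (Fin d) → ENNReal) x := by
  have hm : ∀ i, MeasurableSet (S.tau i '' X) := fun i =>
    (hX.isClosed_image_tau i).measurableSet
  have hXm := hX.isCompact.measurableSet
  -- The pieces cover `X`, which gives a pointwise inequality; the integrals agree because `N r ^ d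
  -- = 1`, and the smaller one is finite.
  refine ae_eq_of_ae_le_of_lintegral_le (Filter.Eventually.of_forall fun x => ?_) ?_ ?_ ?_
  · by_cases hx : x ∈ X
    · have hx' := hx
      rw [hX.eq_iUnion] at hx'
      obtain ⟨i, hi⟩ := Set.mem_iUnion.1 hx'
      rw [Set.indicator_of_mem hx, ← Set.indicator_of_mem hi (1 : EuclideanSpace ℝ (Fin d) → ENNReal)]
      exact Finset.single_le_sum
        (f := fun i => (S.tau i '' X).indicator (1 : EuclideanSpace ℝ (Fin d) → ENNReal) x)
        (fun _ _ => zero_le) (Finset.mem_univ i)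
    · simp [Set.indicator_of_notMem hx]
  · rw [lintegral_indicator_one hXm]
    exact hX.isCompact.measure_lt_top.ne
  · exact (Finset.measurable_sum _ fun i _ => measurable_one.indicator (hm i)).aemeasurable
  · rw [lintegral_finsetSum _ fun i _ => measurable_one.indicator (hm i),
      lintegral_indicator_one hXm]
    simp_rw [lintegral_indicator_one (hm _), hS.volume_image_tau]
    simp [← mul_assoc, hN]

lemma volume_inter_image_tau (hS : S.IsSelfSimilar r) (hX : S.IsAttractor X)
    (hN : (N : ENNReal) * ENNReal.ofReal (r ^ d) = 1) {i j : Fin N} (hij : i ≠ j) :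
    volume (S.tau i '' X ∩ S.tau j '' X) = 0 := by
  have h := sum_indicator_image_tau_ae_eq hS hX hN
  rw [measure_eq_zero_iff_ae_notMem]
  filter_upwards [h] with x hx hxij
  -- At a point of two pieces the sum is at least `2`, while the indicator of `X` is at most `1`.
  have h1 : ∑ k ∈ {i, j}, (S.tau k '' X).indicator (1 : EuclideanSpace ℝ (Fin d) → ENNReal) x ≤
      ∑ k, (S.tau k '' X).indicator (1 : EuclideanSpace ℝ (Fin d) → ENNReal) x :=
    Finset.sum_le_sum_of_subset (Finset.subset_univ _)
  rw [Finset.sum_pair hij, Set.indicator_of_mem hxij.1, Set.indicator_of_mem hxij.2, ← hx] at h1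
  have h2 : X.indicator (1 : EuclideanSpace ℝ (Fin d) → ENNReal) x ≤ 1 := Set.indicator_le_self' (by simp) x
  have h3 := h1.trans h2
  norm_num at h3

/-- If all weights are `r ^ d`, the normalized Lebesgue measure on the attractor is invariant. -/
lemma isInvariantMeasure_volume_attractor (hS : S.IsSelfSimilar r) (hX : S.IsAttractor X)
    (hp : ∀ i, S.p i = r ^ d) (hN : (N : ENNReal) * ENNReal.ofReal (r ^ d) = 1)
    (hpos : volume X ≠ 0) :
    S.IsInvariantMeasure ((volume X)⁻¹ • volume.restrict X) := by
  have hXm := hX.isCompact.measurableSet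
  refine ⟨⟨?_⟩, fun E hE => ?_⟩
  · simp [ENNReal.inv_mul_cancel hpos hX.isCompact.measure_lt_top.ne]
  · have hm : ∀ i, MeasurableSet (S.tau i '' X) := fun i =>
      (hX.isClosed_image_tau i).measurableSet
    have key : volume (E ∩ X) = ∑ i, ENNReal.ofReal (r ^ d) * volume (S.tau i ⁻¹' E ∩ X) := by
      calc volume (E ∩ X) = ∫⁻ x in E, X.indicator (1 : EuclideanSpace ℝ (Fin d) → ENNReal) x := by
            rw [lintegral_indicator_one hXm, Measure.restrict_apply hXm, Set.inter_comm]
        _ = ∫⁻ x in E, ∑ i, (S.tau i '' X).indicator (1 : EuclideanSpace ℝ (Fin d) → ENNReal) x :=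
            lintegral_congr_ae (ae_restrict_of_ae (sum_indicator_image_tau_ae_eq hS hX hN))
        _ = ∑ i, volume (S.tau i '' X ∩ E) := by
            rw [lintegral_finsetSum _ fun i _ => measurable_one.indicator (hm i)]
            simp_rw [lintegral_indicator_one (hm _), Measure.restrict_apply (hm _)]
        _ = _ := by
            refine Finset.sum_congr rfl fun i _ => ?_
            rw [← hS.volume_image_tau i, Set.inter_comm (S.tau i ⁻¹' E), Set.image_inter_preimage]
    simp only [Measure.smul_apply, smul_eq_mul, Measure.restrict_apply hE, key,
      Measure.restrict_apply (S.measurable_tau _ hE), Finset.mul_sum, hp]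
    exact Finset.sum_congr rfl fun i _ => by ring

end AffineIFS

/-! ### Identification of the weights and the density. -/

open AffineIFS

theorem corollary3p11 {d N : ℕ} (S : AffineIFS d N) (r : ℝ) (hS : S.IsSelfSimilar r)
    (X : Set (EuclideanSpace ℝ (Fin d))) (hX : S.IsAttractor X)
    (μ : Measure (EuclideanSpace ℝ (Fin d))) (hμ : S.IsInvariantMeasure μ)
    (hac : μ ≪ volume)
    (hframe : ∃ ν : Measure (EuclideanSpace ℝ (Fin d)), IsFrameMeasure ν μ)
    (I : List (Fin N)) (hI : ∀ i : Fin N, i ∈ I)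
    (x : EuclideanSpace ℝ (Fin d)) (hx : S.tauWord I x = x)
    (hxJ : ∀ J : List (Fin N), J.length = I.length → J ≠ I → x ∉ S.tauWord J '' X) :
    (∀ i j : Fin N, S.p i = S.p j) ∧
    r ^ d = 1 / (N : ℝ) ∧
    S.NoOverlap X μ ∧
    μ.rnDeriv volume =ᵐ[volume] X.indicator (fun _ => 1 / volume X) := by
  have := hμ.isProbabilityMeasure
  obtain ⟨ν, hν⟩ := hframe
  have hp : ∀ i, S.p i = r ^ d := by
    set g := μ.rnDeriv volume
    have hg : Measurable g := Measure.measurable_rnDeriv _ _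
    have hμg : volume.withDensity g = μ := Measure.withDensity_rnDeriv_eq _ _ hac
    have : IsProbabilityMeasure (volume.withDensity g) := by rwa [hμg]
    obtain ⟨m, M, hm, hM, hbd⟩ := exists_bounds_of_isFrameMeasure hg (by rwa [hμg])
    have hupp : ∀ E, MeasurableSet E → μ E ≤ M * volume E := by
      intro E hE
      rw [← hμg, withDensity_apply _ hE, ← setLIntegral_const]
      refine lintegral_mono_ae (ae_restrict_of_ae ?_)
      filter_upwards [hbd] with y hy
      rcases eq_zero_or_pos (g y) with h | h
      · simp [h]
      · exact (hy h).2
    have hV : MeasurableSet {y | 0 < g y} := measurableSet_lt measurable_const hg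
    have hlow : ∀ E, MeasurableSet E → m * volume (E ∩ {y | 0 < g y}) ≤ μ E := by
      intro E hE
      refine le_trans ?_ (measure_mono (Set.inter_subset_left (t := {y | 0 < g y})))
      rw [← hμg, withDensity_apply _ (hE.inter hV), ← setLIntegral_const]
      refine lintegral_mono_ae ?_
      filter_upwards [ae_restrict_of_ae hbd, ae_restrict_mem (hE.inter hV)] with y hy hyE
      exact (hy hyE.2).1
    have hacV : μ ≪ volume.restrict {y | 0 < g y} := by
      refine Measure.AbsolutelyContinuous.mk fun E hE h => ?_
      rw [Measure.restrict_apply hE] at h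
      rw [← hμg, withDensity_apply_eq_zero hg, Set.inter_comm]
      simpa only [pos_iff_ne_zero] using h
    -- An empty word containing every digit would mean that there are no digits, and the weights
    -- would sum to `0`.
    have hINe : I ≠ [] := by
      rintro rfl
      have h0 := S.p_sum
      rw [Finset.sum_eq_zero fun i _ => absurd (hI i) List.not_mem_nil] at h0
      exact zero_ne_one h0
    have hle : ∀ i, S.p i ≤ r ^ d := fun i => by
      simpa [weight_cons, weight_nil] using weight_le hS hX hμ hM hupp [i]
    exact fun i => p_eq_of_pow_le_weight (pow_pos hS.1 _) hle
      (le_weight hS hX hμ hV hm hacV hlow hINe hx hxJ) i (hI i)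
  have hNr : (N : ℝ) * r ^ d = 1 := by
    have := S.p_sum
    simpa [hp] using this
  have hN : (N : ENNReal) * ENNReal.ofReal (r ^ d) = 1 := by
    rw [← ENNReal.ofReal_natCast, ← ENNReal.ofReal_mul (Nat.cast_nonneg N), hNr, ENNReal.ofReal_one]
  have hpos : volume X ≠ 0 := fun h => by
    have h1 := measure_attractor hS hX hμ
    rw [hac h] at h1
    exact zero_ne_one h1
  refine ⟨fun i j => by rw [hp, hp], eq_one_div_of_mul_eq_one_right hNr,
    fun i j hij => hac (volume_inter_image_tau hS hX hN hij), ?_⟩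
  have hXm := hX.isCompact.measurableSet
  have hμX : μ = volume.withDensity (X.indicator fun _ => 1 / volume X) := by
    rw [hμ.unique hS (isInvariantMeasure_volume_attractor hS hX hp hN hpos),
      withDensity_indicator hXm, withDensity_const, one_div]
  rw [hμX]
  exact Measure.rnDeriv_withDensity _ (measurable_const.indicator hXm)
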